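/- Let $n$ be a positive integer. There exists a positive integer $J = J(n)$, depending only on $n$, such that for every field $K$ of characteristic zero and every finite subgroup $G$ of the general linear group $\mathrm{GL}(n,K)$, the group $G$ contains an abelian subgroup $A \le G$ which is characteristic in $G$ (that is, invariant under all automorphisms of the group $G$) and whose index satisfies $|G : A| \le J$. -/

import Mathlib

/-! The entries of `G` lie in a finitely generated `ℚ`-algebra, which maps to `ℂ`, and averaging
makes the resulting complex group unitary. In a finite unitary group, the elements within 1/4 of the
identity commute: commutators shrink the distance to 1, and Frobenius' lemma closes the descent.
Total boundedness of the unitary group bounds the index of the abelian subgroup they generate. The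
Chermak-Delgado argument makes the subgroup characteristic at the cost of squaring the bound. -/

namespace Subgroup

/-! ### Chermak-Delgado measure -/

variable {G : Type*} [Group G]

/-- The Chermak-Delgado measure of a subgroup. -/
noncomputable def chermakDelgado (H : Subgroup G) : ℕ :=
  Nat.card H * Nat.card (centralizer (H : Set G))

theorem card_mul_card_le_card_inf_mul_card_sup [Finite G] (H K : Subgroup G) :
    Nat.card H * Nat.card K ≤ Nat.card ↥(H ⊓ K) * Nat.card ↥(H ⊔ K) := by
  have h1 : Nat.card ↥(H ⊓ K) * K.relIndex H = Nat.card H := by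
    rw [← inf_relIndex_left, ← relIndex_bot_left, ← relIndex_bot_left]
    exact relIndex_mul_relIndex _ _ _ bot_le inf_le_left
  have h2 : Nat.card K * K.relIndex (H ⊔ K) = Nat.card ↥(H ⊔ K) := by
    rw [← relIndex_bot_left, ← relIndex_bot_left]
    exact relIndex_mul_relIndex _ _ _ bot_le le_sup_right
  have : K.IsFiniteRelIndex (H ⊔ K) :=
    ⟨fun h => Nat.card_pos.ne' (h2.symm.trans (by rw [h, mul_zero]))⟩
  have h3 : K.relIndex H ≤ K.relIndex (H ⊔ K) := relIndex_le_of_le_right le_sup_left this.relIndex_ne_zero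
  rw [← h1, ← h2, mul_right_comm, mul_assoc]
  exact Nat.mul_le_mul_left _ (Nat.mul_le_mul_left _ h3)

/-- Apply the cardinality inequality to `H`, `K` and to their centralizers: taking centralizers
reverses inclusions. -/
theorem chermakDelgado_mul_le [Finite G] (H K : Subgroup G) :
    H.chermakDelgado * K.chermakDelgado ≤ (H ⊓ K).chermakDelgado * (H ⊔ K).chermakDelgado := by
  have h1 := card_mul_card_le_card_inf_mul_card_sup H K
  have h2 := card_mul_card_le_card_inf_mul_card_sup
    (centralizer (H : Set G)) (centralizer (K : Set G))
  have h3 : centralizer (H : Set G) ⊓ centralizer (K : Set G) ≤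
      centralizer ((H ⊔ K : Subgroup G) : Set G) := by
    rw [le_centralizer_iff, sup_le_iff]
    exact ⟨le_centralizer_iff.1 inf_le_left, le_centralizer_iff.1 inf_le_right⟩
  have h4 : centralizer (H : Set G) ⊔ centralizer (K : Set G) ≤
      centralizer ((H ⊓ K : Subgroup G) : Set G) :=
    sup_le (centralizer_le fun x hx => hx.1) (centralizer_le fun x hx => hx.2)
  have h5 := h2.trans (Nat.mul_le_mul (card_le_of_le h3) (card_le_of_le h4))
  have h6 := Nat.mul_le_mul h1 h5
  unfold chermakDelgado
  linarith

theorem chermakDelgado_map [Finite G] (φ : G ≃* G) (H : Subgroup G) :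
    (H.map φ.toMonoidHom).chermakDelgado = H.chermakDelgado := by
  have key : ∀ (φ : G ≃* G) (H : Subgroup G),
      H.chermakDelgado ≤ (H.map φ.toMonoidHom).chermakDelgado := by
    intro φ H
    refine Nat.mul_le_mul (card_map_of_injective φ.injective).ge ?_
    rw [← card_map_of_injective (f := φ.toMonoidHom) φ.injective]
    exact card_le_of_le (map_centralizer_le_centralizer_image _ _)
  refine le_antisymm ?_ (key φ H)
  have := key φ.symm (H.map φ.toMonoidHom)
  rwa [map_map, show φ.symm.toMonoidHom.comp φ.toMonoidHom = MonoidHom.id G by ext; simp,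
    map_id] at this

theorem chermakDelgado_le_centralizer [Finite G] (H : Subgroup G) :
    H.chermakDelgado ≤ (centralizer (H : Set G)).chermakDelgado := by
  unfold chermakDelgado
  rw [mul_comm]
  exact Nat.mul_le_mul_left _ (card_le_of_le (le_centralizer_iff.1 le_rfl))

/-- There is a characteristic abelian subgroup that is the least subgroup of maximal
Chermak-Delgado measure. -/
theorem exists_characteristic_isMulCommutative_chermakDelgado_le (G : Type*) [Group G] [Finite G] :
    ∃ P : Subgroup G, P.Characteristic ∧ IsMulCommutative P ∧
      ∀ H : Subgroup G, H.chermakDelgado ≤ P.chermakDelgado := by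
  obtain ⟨M, hM⟩ := Finite.exists_max (chermakDelgado : Subgroup G → ℕ)
  obtain ⟨⟨P, hP⟩, hmin⟩ := @Finite.exists_min
    {H : Subgroup G // ∀ H' : Subgroup G, H'.chermakDelgado ≤ H.chermakDelgado} _ _ ⟨⟨M, hM⟩⟩ _
    (fun H => Nat.card H.1)
  -- Maximizers are closed under intersection, so one of least order lies in all others, including
  -- its images under automorphisms and its centralizer.
  have least : ∀ Q : Subgroup G, P.chermakDelgado ≤ Q.chermakDelgado → P ≤ Q := by
    intro Q hQ
    have hpos : 0 < P.chermakDelgado := Nat.mul_pos Nat.card_pos Nat.card_pos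
    have hinf : P.chermakDelgado ≤ (P ⊓ Q).chermakDelgado := by
      have h1 := chermakDelgado_mul_le P Q
      have h2 := hP (P ⊔ Q)
      by_contra! h
      have := Nat.mul_lt_mul_of_lt_of_le h h2 hpos
      have := Nat.mul_le_mul_left P.chermakDelgado hQ
      omega
    have h3 := hmin ⟨P ⊓ Q, fun H' => (hP H').trans hinf⟩
    have h4 : P ⊓ Q = P := eq_of_le_of_card_ge inf_le_left h3
    exact inf_eq_left.1 h4
  refine ⟨P, characteristic_iff_le_map.2 fun φ => least _ (chermakDelgado_map φ P).ge, ?_, hP⟩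
  exact le_centralizer_iff_isMulCommutative.1 (least _ (chermakDelgado_le_centralizer P))

/-- An abelian `A` has measure at least `|A|²`, while that of `P` is at most `|P||G|`. -/
theorem exists_characteristic_isMulCommutative_index_le [Finite G] (A : Subgroup G)
    [hA : IsMulCommutative A] :
    ∃ P : Subgroup G, P.Characteristic ∧ IsMulCommutative P ∧ P.index ≤ A.index ^ 2 := by
  obtain ⟨P, hc, hab, hmax⟩ := exists_characteristic_isMulCommutative_chermakDelgado_le G
  refine ⟨P, hc, hab, ?_⟩
  have h1 : Nat.card A * Nat.card A ≤ Nat.card P * Nat.card G := by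
    calc Nat.card A * Nat.card A ≤ A.chermakDelgado :=
          Nat.mul_le_mul_left _ (card_le_of_le A.le_centralizer)
      _ ≤ P.chermakDelgado := hmax A
      _ ≤ _ := Nat.mul_le_mul_left _ (card_le_card_group _)
  have h2 := A.card_mul_index
  have h3 := P.card_mul_index
  have hpos : 0 < Nat.card G * Nat.card G := Nat.mul_pos Nat.card_pos Nat.card_pos
  refine Nat.le_of_mul_le_mul_left ?_ hpos
  calc Nat.card G * Nat.card G * P.index
      = (Nat.card A * Nat.card A) * (A.index ^ 2 * P.index) := by rw [← h2]; ring
    _ ≤ (Nat.card P * Nat.card G) * (A.index ^ 2 * P.index) := Nat.mul_le_mul_right _ h1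
    _ = (Nat.card P * P.index) * Nat.card G * A.index ^ 2 := by ring
    _ = _ := by rw [h3]

end Subgroup

/-! ### Common eigenvectors -/

open Module.End in
-- `N` is semisimple, so `N ≠ 1` forces an eigenvalue other than 1, and `A` preserves its
-- eigenspace.
theorem Module.End.exists_common_eigenvector_of_pow_eq_one {V : Type*} [AddCommGroup V] [Module ℂ V]
    [FiniteDimensional ℂ V] {N A : Module.End ℂ V} (hc : Commute N A) {m : ℕ} (hm : m ≠ 0)
    (hN : N ^ m = 1) (hN1 : N ≠ 1) :
    ∃ (v : V) (ν a : ℂ), v ≠ 0 ∧ ν ≠ 1 ∧ N v = ν • v ∧ A v = a • v := by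
  have hs : N.IsSemisimple := by
    refine isSemisimple_of_squarefree_aeval_eq_zero (p := Polynomial.X ^ m - 1) ?_ (by simp [hN])
    exact (Polynomial.X_pow_sub_one_separable_iff.2 (by exact_mod_cast hm)).squarefree
  have hs' : (N - algebraMap ℂ _ 1).IsSemisimple := isSemisimple_sub_algebraMap_iff.2 hs
  obtain ⟨μ, hμ, hμ0⟩ : ∃ μ, (N - algebraMap ℂ _ 1).HasEigenvalue μ ∧ μ ≠ 0 := by
    by_contra! h
    exact hN1 (by simpa [sub_eq_zero] using hs'.eq_zero_iff_forall_eigenvalue.2 h)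
  obtain ⟨w, hw⟩ := hμ.exists_hasEigenvector
  have hNw : N w = (μ + 1) • w := by
    have := hw.apply_eq_smul
    simp only [map_one, LinearMap.sub_apply, Module.End.one_apply] at this
    rw [add_smul, ← this]; simp
  have hmaps : Set.MapsTo A (N.eigenspace (μ + 1)) (N.eigenspace (μ + 1)) :=
    mapsTo_genEigenspace_of_comm hc _ _
  have : Nontrivial (N.eigenspace (μ + 1)) :=
    ⟨⟨⟨w, mem_eigenspace_iff.2 hNw⟩, 0, fun h => hw.2 (congrArg Subtype.val h)⟩⟩
  obtain ⟨a, ha⟩ := exists_eigenvalue (A.restrict hmaps)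
  obtain ⟨v, hv⟩ := ha.exists_hasEigenvector
  refine ⟨v, μ + 1, a, fun h => hv.2 (Subtype.ext h), by simpa using hμ0,
    mem_eigenspace_iff.1 v.2, ?_⟩
  exact congrArg Subtype.val hv.apply_eq_smul

/-! ### Reduction to complex unitary groups -/

theorem Algebra.FiniteType.nonempty_ringHom_complex (R : Type*) [CommRing R] [Nontrivial R]
    [Algebra ℚ R] [Algebra.FiniteType ℚ R] : Nonempty (R →+* ℂ) := by
  obtain ⟨m, hm⟩ := Ideal.exists_maximal R
  let _ := Ideal.Quotient.field m
  have := finite_of_finite_type_of_isJacobsonRing ℚ (R ⧸ m)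
  exact ⟨((IsAlgClosed.lift : (R ⧸ m) →ₐ[ℚ] ℂ) : (R ⧸ m) →+* ℂ).comp (Ideal.Quotient.mk m)⟩

/-- A finite matrix group over a field of characteristic zero has a faithful complex
representation of the same degree. -/
theorem exists_injective_monoidHom_complex_matrix {ι K G : Type*} [Fintype ι] [DecidableEq ι]
    [Field K] [CharZero K] [Group G] [Finite G] (r : G →* Matrix ι ι K)
    (hr : Function.Injective r) :
    ∃ f : G →* Matrix ι ι ℂ, Function.Injective f := by
  -- Adjoining inverses of the nonzero entries of `r g - 1` makes them units, so no ring map to `ℂ`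
  -- kills them and faithfulness survives.
  let S : Set K := (Set.range fun p : G × ι × ι => r p.1 p.2.1 p.2.2) ∪
    Set.range fun p : G × ι × ι => ((r p.1 - 1) p.2.1 p.2.2)⁻¹
  have hS : S.Finite := (Set.finite_range _).union (Set.finite_range _)
  let R := Algebra.adjoin ℚ S
  have : Algebra.FiniteType ℚ R := .adjoin_of_finite hS
  obtain ⟨φ⟩ := Algebra.FiniteType.nonempty_ringHom_complex R
  have hmem : ∀ g i j, r g i j ∈ R := fun g i j =>
    Algebra.subset_adjoin (Or.inl ⟨(g, i, j), rfl⟩)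
  have hmem' : ∀ g i j, ((r g - 1) i j)⁻¹ ∈ R := fun g i j =>
    Algebra.subset_adjoin (Or.inr ⟨(g, i, j), rfl⟩)
  let s : G →* Matrix ι ι R :=
    { toFun := fun g => Matrix.of fun i j => ⟨r g i j, hmem g i j⟩
      map_one' := by
        ext i j
        simp only [map_one, Matrix.of_apply, Matrix.one_apply]
        split_ifs <;> rfl
      map_mul' := fun g h => by
        ext i j
        simp [Matrix.mul_apply] }
  refine ⟨φ.mapMatrix.toMonoidHom.comp s, ?_⟩
  rw [injective_iff_map_eq_one]
  intro g hg
  apply hr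
  rw [map_one]
  by_contra hne
  obtain ⟨i, j, hij⟩ : ∃ i j, (r g - 1) i j ≠ 0 := by
    by_contra! h
    exact hne (sub_eq_zero.1 (Matrix.ext h))
  have hunit : (s g - 1) i j * ⟨_, hmem' g i j⟩ = 1 := by
    apply Subtype.ext
    rw [MulMemClass.coe_mul, OneMemClass.coe_one]
    convert mul_inv_cancel₀ hij
    simp only [Matrix.sub_apply, Matrix.one_apply]
    split_ifs <;> rfl
  have h0 : φ ((s g - 1) i j) = 0 := by
    have h1 : φ.mapMatrix (s g - 1) = 0 := by
      rw [map_sub, map_one, sub_eq_zero]; exact hg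
    exact congrFun (congrFun h1 i) j
  have := congrArg φ hunit
  rw [map_mul, h0, zero_mul, map_one] at this
  exact zero_ne_one this

/-- A finite subgroup of the units of a C*-algebra is conjugate to a group of unitaries. -/
theorem CStarAlgebra.exists_injective_monoidHom_unitary {A G : Type*} [CStarAlgebra A]
    [PartialOrder A] [StarOrderedRing A] [Group G] [Finite G] (r : G →* A)
    (hr : Function.Injective r) :
    ∃ f : G →* unitary A, Function.Injective f := by
  have := Fintype.ofFinite G
  -- This sum is an invariant form; factoring it as `star c * c`, conjugation by `c` makes every `r
  -- g` unitary.
  have hpos : IsStrictlyPositive (∑ g, star (r g) * r g) := by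
    classical
    rw [← Finset.add_sum_erase _ _ (Finset.mem_univ (1 : G))]
    refine IsStrictlyPositive.add_nonneg ?_ (Finset.sum_nonneg fun g _ => star_mul_self_nonneg _)
    simp
  obtain ⟨b, ⟨c, rfl⟩, hc⟩ := CStarAlgebra.isStrictlyPositive_iff_eq_star_mul_self.1 hpos
  have hinv : ∀ g, star (r g) * (star (c : A) * c) * r g = star (c : A) * c := by
    intro g
    rw [← hc, Finset.mul_sum, Finset.sum_mul]
    refine Fintype.sum_equiv (Equiv.mulRight g) _ _ fun h => ?_
    simp [mul_assoc]
  have hstar : ∀ g, star ((c : A) * r g * (↑c⁻¹ : A)) * (c * r g * (↑c⁻¹ : A)) = 1 := by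
    intro g
    calc star ((c : A) * r g * (↑c⁻¹ : A)) * (c * r g * (↑c⁻¹ : A))
        = star (↑c⁻¹ : A) * (star (r g) * (star (c : A) * c) * r g) * (↑c⁻¹ : A) := by
          simp only [star_mul, mul_assoc]
      _ = star ((c : A) * (↑c⁻¹ : A)) * (c * (↑c⁻¹ : A)) := by
          rw [hinv]; simp only [star_mul, mul_assoc]
      _ = 1 := by simp
  have hmul : ∀ g h, (c : A) * r (g * h) * (↑c⁻¹ : A) =
      (c * r g * (↑c⁻¹ : A)) * (c * r h * (↑c⁻¹ : A)) := by
    intro g h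
    simp [mul_assoc]
  have hunit : ∀ g, (c : A) * r g * (↑c⁻¹ : A) ∈ unitary A := by
    intro g
    refine Unitary.mem_iff.2 ⟨hstar g, ?_⟩
    have h1 : (c * r g * (↑c⁻¹ : A)) * (c * r g⁻¹ * (↑c⁻¹ : A)) = 1 := by
      rw [← hmul]; simp
    rw [left_inv_eq_right_inv (hstar g) h1, h1]
  refine ⟨{ toFun := fun g => ⟨_, hunit g⟩, map_one' := ?_, map_mul' := ?_ }, ?_⟩
  · ext1; simp
  · intro g h; ext1; exact hmul g h
  · intro g h hgh
    have h1 : (c : A) * r g * (↑c⁻¹ : A) = c * r h * (↑c⁻¹ : A) := congrArg Subtype.val hgh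
    exact hr (c.isUnit.mul_left_cancel (c⁻¹.isUnit.mul_right_cancel h1))

/-! ### Commutators of unitaries near the identity -/

open scoped commutatorElement

/-- `ab - ba` is unchanged when 1 is subtracted from both factors, and the unitary `(ba)⁻¹`
preserves norms. -/
theorem Unitary.norm_commutator_sub_one_le {A : Type*} [CStarAlgebra A] (a b : unitary A) :
    ‖((⁅a, b⁆ : unitary A) : A) - 1‖ ≤ 2 * ‖(a : A) - 1‖ * ‖(b : A) - 1‖ := by
  have h : ((⁅a, b⁆ : unitary A) : A) - 1 =
      (((a : A) - 1) * (b - 1) - (b - 1) * (a - 1)) * ((b * a)⁻¹ : unitary A) := by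
    have h1 : ((b * a : unitary A) : A) * ((b * a)⁻¹ : unitary A) = 1 := by
      rw [← Submonoid.coe_mul, mul_inv_cancel, Submonoid.coe_one]
    have h2 : ((a : A) - 1) * (b - 1) - (b - 1) * (a - 1) =
      (a * b : unitary A) - (b * a : unitary A) := by
      simp only [Submonoid.coe_mul]; noncomm_ring
    rw [h2, sub_mul, h1, ← Submonoid.coe_mul, mul_inv_rev, commutatorElement_def]
    simp only [mul_assoc]
  rw [h, CStarRing.norm_mul_coe_unitary]
  calc _ ≤ ‖((a : A) - 1) * (b - 1)‖ + ‖((b : A) - 1) * (a - 1)‖ := norm_sub_le _ _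
    _ ≤ ‖(a : A) - 1‖ * ‖(b : A) - 1‖ + ‖(b : A) - 1‖ * ‖(a : A) - 1‖ :=
      add_le_add (norm_mul_le _ _) (norm_mul_le _ _)
    _ = _ := by ring

section Frobenius

variable {E : Type*} [NormedAddCommGroup E] [InnerProductSpace ℂ E] [FiniteDimensional ℂ E]
  [CompleteSpace E]

/-- Frobenius' lemma: a unitary that commutes with its commutator with a unitary close to `1`
commutes with that unitary. -/
theorem Unitary.commute_of_commute_commutator {a b : unitary (E →L[ℂ] E)}
    (hc : Commute ⁅b, a⁆ a) (hfin : IsOfFinOrder ⁅b, a⁆) (hb : ‖(b : E →L[ℂ] E) - 1‖ < 1) :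
    Commute a b := by
  by_contra hab
  obtain ⟨m, hm, hpow⟩ := isOfFinOrder_iff_pow_eq_one.1 hfin
  have hne : ⁅b, a⁆ ≠ 1 := fun h => hab (commutatorElement_eq_one_iff_commute.1 h).symm
  let τ : unitary (E →L[ℂ] E) →* Module.End ℂ E :=
    (ContinuousLinearMap.toLinearMapRingHom : (E →L[ℂ] E) →+* (E →ₗ[ℂ] E)).toMonoidHom.comp
      (unitary (E →L[ℂ] E)).subtype
  have hτ : ∀ u v, τ u v = (u : E →L[ℂ] E) v := fun _ _ => rfl
  have hinj : Function.Injective τ := fun u v h =>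
    Subtype.ext (ContinuousLinearMap.coe_injective h)
  have hinner : ∀ u v w, inner ℂ (τ u v) (τ u w) = inner ℂ v w := fun u v w => by
    rw [hτ, hτ, ← ContinuousLinearMap.adjoint_inner_right, ← ContinuousLinearMap.star_eq_adjoint,
      ← mul_apply_eq_comp, Unitary.coe_star_mul_self, one_apply_eq_self]
  obtain ⟨v, ν, l, hv, hν, hNv, hav⟩ :=
    Module.End.exists_common_eigenvector_of_pow_eq_one (hc.map τ) hm.ne'
    (by rw [← map_pow, hpow, map_one]) (fun h => hne (hinj (h.trans (map_one τ).symm)))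
  set w := τ b⁻¹ v with hw
  have hbw : τ b w = v := by
    rw [hw, ← Module.End.mul_apply, ← map_mul, mul_inv_cancel, map_one, Module.End.one_apply]
  have haw : τ a w = (l * ν) • w := by
    have h1 : a * b⁻¹ = b⁻¹ * (⁅b, a⁆ * a) := by rw [commutatorElement_def]; group
    rw [hw, ← Module.End.mul_apply, ← map_mul, h1]
    simp only [map_mul, Module.End.mul_apply, hav, hNv, map_smul, smul_smul]
  -- `v` and `w = b⁻¹v` are eigenvectors of `a` for the distinct values `l` and `lν`. Orthogonality
  -- gives `‖v - w‖ = √2‖v‖`, too far for `‖b - 1‖ < 1`.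
  have horth : inner ℂ v w = (0 : ℂ) := by
    have h1 := hinner a v w
    have h2 := hinner a v v
    rw [hav, haw] at h1
    rw [hav] at h2
    simp only [inner_smul_left, inner_smul_right] at h1 h2
    have h3 : inner ℂ v v ≠ (0 : ℂ) := inner_self_ne_zero.2 hv
    have h4 : starRingEnd ℂ l * l = 1 := mul_right_cancel₀ h3 (by linear_combination h2)
    have h5 : (ν - 1) * inner ℂ v w = (0 : ℂ) := by
      linear_combination h1 - ν * inner ℂ v w * h4
    exact (mul_eq_zero.1 h5).resolve_left (sub_ne_zero.2 hν)
  have hnorm : ‖w‖ = ‖v‖ := by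
    have := hinner b w w
    rw [hbw, inner_self_eq_norm_sq_to_K, inner_self_eq_norm_sq_to_K] at this
    have h2 : ‖v‖ ^ 2 = ‖w‖ ^ 2 := by exact_mod_cast this
    exact ((sq_eq_sq₀ (norm_nonneg _) (norm_nonneg _)).1 h2).symm
  have hvw : ‖v - w‖ ≤ ‖(b : E →L[ℂ] E) - 1‖ * ‖v‖ := by
    have h1 : v - w = ((b : E →L[ℂ] E) - 1) w := by
      rw [sub_apply, one_apply_eq_self, ← hτ, hbw]
    rw [h1, ← hnorm]
    exact ContinuousLinearMap.le_opNorm _ _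
  have hvpos : 0 < ‖v‖ := norm_pos_iff.2 hv
  have hpyth : ‖v - w‖ ^ 2 = ‖v‖ ^ 2 + ‖w‖ ^ 2 := by
    rw [@norm_sub_sq ℂ, horth]; simp
  have hlt : ‖v - w‖ < ‖v‖ := hvw.trans_lt (mul_lt_of_lt_one_left hvpos hb)
  nlinarith [norm_nonneg (v - w), sq_nonneg ‖w‖]

theorem Unitary.commute_of_norm_sub_one_lt {G : Type*} [Group G] [Finite G]
    (f : G →* unitary (E →L[ℂ] E)) (hf : Function.Injective f) {g h : G}
    (hg : ‖(f g : E →L[ℂ] E) - 1‖ < 1 / 4) (hh : ‖(f h : E →L[ℂ] E) - 1‖ < 1 / 4) :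
    Commute g h := by
  by_contra hgh
  -- Take the counterexample `k` nearest to 1. Since `2 · 1/4 < 1`, `⁅k, g⁆` is nearer still, hence
  -- commutes with `g`.
  obtain ⟨⟨k, hk, hgk⟩, hmin⟩ := @Finite.exists_min
    {k : G // ‖(f k : E →L[ℂ] E) - 1‖ < 1 / 4 ∧ ¬ Commute g k} _ _ ⟨⟨h, hh, hgh⟩⟩ _
    (fun k => ‖(f k : E →L[ℂ] E) - 1‖)
  have hkpos : 0 < ‖(f k : E →L[ℂ] E) - 1‖ := by
    rw [norm_pos_iff, sub_ne_zero]
    intro h1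
    have h2 : f k = f 1 := by rw [map_one]; exact Subtype.ext h1
    exact hgk (hf h2 ▸ Commute.one_right g)
  have hlt : ‖(f ⁅k, g⁆ : E →L[ℂ] E) - 1‖ < ‖(f k : E →L[ℂ] E) - 1‖ := by
    rw [map_commutatorElement]
    have := Unitary.norm_commutator_sub_one_le (f k) (f g)
    nlinarith
  have hcomm : Commute g ⁅k, g⁆ := by
    by_contra hn
    exact (hmin ⟨_, hlt.trans hk, hn⟩).not_gt hlt
  refine hgk (hf ?_)
  have := Unitary.commute_of_commute_commutator (a := f g) (b := f k)
    (by rw [← map_commutatorElement]; exact (hcomm.map f).symm)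
    (by rw [← map_commutatorElement]; exact f.isOfFinOrder (isOfFinOrder_of_finite _))
    (by linarith)
  rw [map_mul, map_mul]
  exact this

/-! ### Bounding the index -/

theorem Unitary.exists_isMulCommutative_index_le (E : Type*) [NormedAddCommGroup E]
    [InnerProductSpace ℂ E] [FiniteDimensional ℂ E] [CompleteSpace E] :
    ∃ J : ℕ, ∀ (G : Type*) [Group G] [Finite G] (f : G →* unitary (E →L[ℂ] E)),
      Function.Injective f → ∃ A : Subgroup G, IsMulCommutative A ∧ A.index ≤ J := by
  have hbdd : Bornology.IsBounded (unitary (E →L[ℂ] E) : Set (E →L[ℂ] E)) := by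
    refine isBounded_iff_forall_norm_le.2 ⟨1, fun u hu => ?_⟩
    nontriviality E →L[ℂ] E
    exact (CStarRing.norm_of_mem_unitary hu).le
  have : ProperSpace (E →L[ℂ] E) := FiniteDimensional.proper ℂ _
  have htot : TotallyBounded (unitary (E →L[ℂ] E) : Set (E →L[ℂ] E)) :=
    hbdd.isCompact_closure.totallyBounded.subset subset_closure
  obtain ⟨t, ht, hcover⟩ := Metric.totallyBounded_iff.1 htot (1 / 8) (by norm_num)
  refine ⟨Nat.card t, fun G _ _ f hf => ?_⟩
  let A := Subgroup.closure {g : G | ‖(f g : E →L[ℂ] E) - 1‖ < 1 / 4}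
  refine ⟨A, Subgroup.isMulCommutative_closure fun x hx y hy =>
    (Unitary.commute_of_norm_sub_one_lt f hf hx hy).eq, ?_⟩
  have hball : ∀ g : G, ∃ y : t, dist (f g : E →L[ℂ] E) y < 1 / 8 := fun g => by
    simpa using hcover (f g).2
  choose c hc using hball
  have : Finite t := ht
  -- Representatives in one ball of radius 1/8 differ by an element within 1/4 of 1, so each ball
  -- serves at most one coset.
  refine Nat.card_le_card_of_injective (fun q : G ⧸ A => c q.out) fun p q hpq => ?_
  rw [← p.out_eq', ← q.out_eq', QuotientGroup.eq]
  refine Subgroup.subset_closure ?_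
  have h1 : dist (f q.out : E →L[ℂ] E) (f p.out) < 1 / 4 := by
    have h2 := hc p.out
    have h3 := hc q.out
    rw [show c p.out = c q.out from hpq] at h2
    have := dist_triangle_right (f q.out : E →L[ℂ] E) (f p.out) (c q.out)
    linarith
  rw [dist_eq_norm, ← CStarRing.norm_coe_unitary_mul (f p.out)⁻¹, mul_sub, ← Submonoid.coe_mul,
    ← Submonoid.coe_mul, inv_mul_cancel, ← map_inv, ← map_mul] at h1
  exact h1

end Frobenius

theorem mainTheorem7 (n : ℕ) (hn : 0 < n) :
    ∃ J : ℕ, 0 < J ∧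
      ∀ (K : Type*) [Field K] [CharZero K]
        (G : Subgroup (Matrix.GeneralLinearGroup (Fin n) K)) [Finite G],
        ∃ A : Subgroup G, A.Characteristic ∧ IsMulCommutative A ∧ A.index ≤ J := by
  obtain ⟨J, hJ⟩ := Unitary.exists_isMulCommutative_index_le (EuclideanSpace ℂ (Fin n))
  -- The `+ 1` only secures positivity.
  refine ⟨J ^ 2 + 1, Nat.succ_pos _, fun K _ _ G _ => ?_⟩
  obtain ⟨r, hr⟩ := exists_injective_monoidHom_complex_matrix
    ((Units.coeHom (Matrix (Fin n) (Fin n) K)).comp G.subtype)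
    (Units.val_injective.comp G.subtype_injective)
  let e := (Matrix.toEuclideanCLM (n := Fin n) (𝕜 := ℂ)).toRingEquiv
  obtain ⟨f, hf⟩ := CStarAlgebra.exists_injective_monoidHom_unitary
    (e.toMulEquiv.toMonoidHom.comp r) (e.injective.comp hr)
  obtain ⟨A, hA, hAJ⟩ := hJ G f hf
  obtain ⟨P, hc, hab, hP⟩ := A.exists_characteristic_isMulCommutative_index_le
  exact ⟨P, hc, hab, hP.trans ((Nat.pow_le_pow_left hAJ 2).trans (Nat.le_succ _))⟩
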